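/- Let $E$ be the curve over $\mathbb{Q}$ with Weierstrass equation $$y^2 + xy + y = x^3 - x^2 - 20067762415575526585033208209338542750930230312178956502\,x$$ $$\qquad {} + 34481611795030556467032985690390720374855944359319180361266008296291939448732243429.$$ For $Q \in E(\mathbb{Q})$ let $h(Q)$ be the absolute logarithmic Weil height of the $x$-coordinate of $Q$ (that is, $\log\max(|a|,|b|)$ if $x(Q)=a/b$ in lowest terms), with $h(O)=0$ at the point at infinity $O$; let $\hat h(Q) = \lim_{n\to\infty} 4^{-n} h(2^n Q)$ be the canonical height, and let $\langle P,Q\rangle = \tfrac12\bigl(\hat h(P+Q)-\hat h(P)-\hat h(Q)\bigr)$ be the canonical height pairing. Then $E$ is an elliptic curve, the limit defining $\hat h(Q)$ exists for every $Q \in E(\mathbb{Q})$, and $E$ has at least $28$ independent rational points: there are $P_1,\dots,P_{28} \in E(\mathbb{Q})$ whose canonical height regulator $\det\bigl(\langle P_i,P_j\rangle\bigr)_{1\le i,j\le 28}$ is strictly positive and which are linearly independent over $\mathbb{Z}$. In particular the rank of $E(\mathbb{Q})$ is at least $28$. -/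

import Mathlib

open scoped Topology

noncomputable section

namespace RankTwentyEight

/-- The Weierstrass curve `y² + xy + y = x³ - x² - A x + B` over `ℚ`
(coefficients in the order `a₁, a₂, a₃, a₄, a₆`). -/
def curve : WeierstrassCurve ℚ where
  a₁ := 1
  a₂ := -1
  a₃ := 1
  a₄ := -20067762415575526585033208209338542750930230312178956502
  a₆ := 34481611795030556467032985690390720374855944359319180361266008296291939448732243429

variable {W : WeierstrassCurve.Affine ℚ}

/-- The logarithmic naive height `h(P)` of a rational point: the absolute logarithmic Weil height
of its `x`-coordinate, and `0` at the point at infinity. -/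
def naiveHeight : W.Point → ℝ
  | .zero => 0
  | .some x _ _ => Height.logHeight₁ x

/-- The canonical (Néron–Tate) height `ĥ(P) = lim h(2ⁿ P) / 4ⁿ`. -/
def canonicalHeight (P : W.Point) : ℝ :=
  Filter.limUnder Filter.atTop fun n : ℕ => naiveHeight ((2 ^ n : ℕ) • P) / (4 : ℝ) ^ n

/-- The canonical height pairing `⟨P, Q⟩ = (ĥ(P + Q) - ĥ(P) - ĥ(Q)) / 2`. -/
def heightPairing (P Q : W.Point) : ℝ :=
  (canonicalHeight (P + Q) - canonicalHeight P - canonicalHeight Q) / 2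

/-- The canonical height regulator of a finite family of rational points: the determinant of
its Gram matrix for the canonical height pairing. -/
def regulator {r : ℕ} (P : Fin r → W.Point) : ℝ :=
  (Matrix.of fun i j => heightPairing (P i) (P j)).det

end RankTwentyEight

end

/-! Heights. The map sending the pair `(x(P), x(Q))` to `(x(P+Q), x(P-Q))`, up to order, is given by
quadratic forms on the symmetric square of the `x`-line (`exists_smul_sym2x_add_sub`). Hence the
naive height obeys the parallelogram law up to a bounded error, and Tate's limit exists, is
quadratic, and stays at bounded distance from the naive height. Northcott finiteness therefore
passes to the canonical height. A kernel vector of the Gram matrix of an independent family would,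
through its rounded multiples, give infinitely many points of bounded height; so the matrix is
positive definite (`posDef_gramMatrix`) and the regulator is positive.

Independence. This is a 2-descent carried out locally. For a root θ of the 2-division cubic in
`ℚ_[p]`, `P ↦ x(P) - θ` is a homomorphism to square classes. Composing with the quadratic character
modulo `p` turns a relation among the points into a linear equation over `ZMod 2` for its
coefficients. The 28 chosen pairs (prime, root) give an invertible matrix, so every relation has
even coefficients. As there is no rational 2-torsion, relations can be halved forever and so vanish.
-/

namespace RankTwentyEight

open Filter Matrix

/-! ### Tate's limit for functions with an approximate parallelogram law. -/

section QuasiParallelogram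

variable {G : Type*} [AddCommGroup G] {h : G → ℝ} {C : ℝ}

/-- If `h` satisfies the parallelogram law up to a bounded error, then `h(2ⁿ P) / 4ⁿ` converges
to a limit at bounded distance from `h(P)`. -/
theorem exists_tendsto_div_four_pow
    (hC : ∀ P Q, |h (P + Q) + h (P - Q) - 2 * (h P + h Q)| ≤ C) (P : G) :
    ∃ a, Tendsto (fun n : ℕ => h ((2 ^ n : ℕ) • P) / (4 : ℝ) ^ n) atTop (𝓝 a) ∧
      |h P - a| ≤ (C + |h 0|) / 4 / (1 - 1 / 4) := by
  -- The case `P = Q` of the law: doubling multiplies `h` by 4 up to a constant, so successive terms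
  -- differ by a geometric sequence of ratio 1/4.
  have hdouble (Q : G) : |h (Q + Q) - 4 * h Q| ≤ C + |h 0| := by
    have h1 := hC Q Q
    rw [sub_self] at h1
    have h2 := neg_abs_le (h 0)
    have h3 := le_abs_self (h 0)
    rw [abs_le] at h1 ⊢
    constructor <;> linarith [h1.1, h1.2]
  set u : ℕ → ℝ := fun n => h ((2 ^ n : ℕ) • P) / (4 : ℝ) ^ n with hu
  have hstep (n : ℕ) : dist (u n) (u (n + 1)) ≤ (C + |h 0|) / 4 * (1 / 4 : ℝ) ^ n := by
    have h4 : (0 : ℝ) < 4 ^ n := by positivity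
    have h5 : u n - u (n + 1)
        = -(h ((2 ^ n : ℕ) • P + (2 ^ n : ℕ) • P) - 4 * h ((2 ^ n : ℕ) • P)) / (4 * 4 ^ n) := by
      simp only [hu]
      rw [← two_nsmul, ← mul_smul, ← pow_succ']
      field_simp
      ring
    rw [Real.dist_eq, h5, abs_div, abs_neg, abs_of_pos (by positivity : (0 : ℝ) < 4 * 4 ^ n)]
    have h6 : (C + |h 0|) / 4 * (1 / 4 : ℝ) ^ n = (C + |h 0|) / (4 * 4 ^ n) := by
      rw [one_div, inv_pow]
      field_simp
    rw [h6]
    gcongr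
    exact hdouble _
  obtain ⟨a, ha⟩ := cauchySeq_tendsto_of_complete
    (cauchySeq_of_le_geometric (1 / 4) _ (by norm_num) hstep)
  refine ⟨a, ha, ?_⟩
  have := dist_le_of_le_geometric_of_tendsto₀ (1 / 4) _ (by norm_num) hstep ha
  simpa [hu, Real.dist_eq] using this

/-- The limit of `h(2ⁿ P) / 4ⁿ` satisfies the exact parallelogram law. -/
theorem parallelogram_of_tendsto
    (hC : ∀ P Q, |h (P + Q) + h (P - Q) - 2 * (h P + h Q)| ≤ C) {H : G → ℝ}
    (hH : ∀ P, Tendsto (fun n : ℕ => h ((2 ^ n : ℕ) • P) / (4 : ℝ) ^ n) atTop (𝓝 (H P)))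
    (P Q : G) : H (P + Q) + H (P - Q) = 2 * (H P + H Q) := by
  have hlim := (((hH (P + Q)).add (hH (P - Q))).sub (((hH P).add (hH Q)).const_mul 2))
  have hzero : Tendsto (fun n : ℕ => C * (1 / 4 : ℝ) ^ n) atTop (𝓝 0) := by
    simpa using (tendsto_pow_atTop_nhds_zero_of_lt_one (r := (1 / 4 : ℝ))
      (by norm_num) (by norm_num)).const_mul C
  have := tendsto_nhds_unique hlim (squeeze_zero_norm (fun n => ?_) hzero)
  · linarith
  · have h1 := hC ((2 ^ n : ℕ) • P) ((2 ^ n : ℕ) • Q)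
    rw [← smul_add, ← smul_sub] at h1
    have h4 : (0 : ℝ) < 4 ^ n := by positivity
    have h5 : h ((2 ^ n : ℕ) • (P + Q)) / (4 : ℝ) ^ n + h ((2 ^ n : ℕ) • (P - Q)) / (4 : ℝ) ^ n
        - 2 * (h ((2 ^ n : ℕ) • P) / (4 : ℝ) ^ n + h ((2 ^ n : ℕ) • Q) / (4 : ℝ) ^ n)
        = (h ((2 ^ n : ℕ) • (P + Q)) + h ((2 ^ n : ℕ) • (P - Q))
          - 2 * (h ((2 ^ n : ℕ) • P) + h ((2 ^ n : ℕ) • Q))) / (4 : ℝ) ^ n := by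
      ring
    rw [h5, Real.norm_eq_abs, abs_div, abs_of_pos h4, one_div, inv_pow, ← div_eq_mul_inv]
    gcongr

end QuasiParallelogram

/-! ### Quadratic functions and definiteness of their Gram matrices. -/

section Gram

theorem tendsto_floor_mul_div (x : ℝ) :
    Tendsto (fun m : ℕ => ((⌊x * (m : ℝ)⌋ : ℤ) : ℝ) / (m : ℝ)) atTop (𝓝 x) := by
  have h0 : Tendsto (fun m : ℕ => Int.fract (x * (m : ℝ)) / (m : ℝ)) atTop (𝓝 0) :=
    squeeze_zero (fun m => div_nonneg (Int.fract_nonneg _) m.cast_nonneg)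
      (fun m => div_le_div_of_nonneg_right (Int.fract_lt_one _).le m.cast_nonneg)
      tendsto_one_div_atTop_nhds_zero_nat
  have h1 := (tendsto_const_nhds (x := x)).sub h0
  rw [sub_zero] at h1
  refine h1.congr' ?_
  filter_upwards [eventually_gt_atTop 0] with m hm
  have : (m : ℝ) ≠ 0 := by positivity
  rw [Int.fract]
  field_simp
  ring

variable {G : Type*} [AddCommGroup G] {H : G → ℝ}

/-- The polarization of a function satisfying the parallelogram law is biadditive. -/
noncomputable def polarHom (H : G → ℝ) (par : ∀ P Q, H (P + Q) + H (P - Q) = 2 * (H P + H Q)) :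
    G →+ G →+ ℝ :=
  have h0 : H 0 = 0 := by
    have := par 0 0
    simp only [add_zero, sub_zero] at this
    linarith
  have key (P Q R : G) : H (P + Q + R) - H (P + Q) - H R
      = (H (P + R) - H P - H R) + (H (Q + R) - H Q - H R) := by
    have h1 := par (P + R) Q
    have h2 := par (P - Q) R
    have h3 := par P Q
    have h4 := par (P - Q + R) Q
    have h5 := par (P - R) Q
    have h6 := par (Q + R) P
    have h7 := par (Q - R) P
    have h8 := par P R
    have h9 := par Q R
    have h10 := par (P + Q) R
    have hneg (A : G) : H (-A) = H A := by
      have := par 0 A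
      simp only [zero_add, zero_sub, h0] at this
      linarith
    have e1 : P + R + Q = P + Q + R := by abel
    have e2 : P + R - Q = P - Q + R := by abel
    have e3 : P - R + Q = P + Q - R := by abel
    have e4 : P - R - Q = -(Q + R - P) := by abel
    have e5 : Q + R + P = P + Q + R := by abel
    have e6 : Q - R + P = P + Q - R := by abel
    have e7 : Q - R - P = -(P - Q + R) := by abel
    rw [e1, e2] at h1
    rw [e3, e4, hneg] at h5
    rw [e5] at h6
    rw [e6, e7, hneg] at h7
    linarith
  AddMonoidHom.mk' (fun P => AddMonoidHom.mk' (fun Q => (H (P + Q) - H P - H Q) / 2) fun Q R => by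
      have := key Q R P
      simp only [add_comm _ P] at this
      linarith) fun P Q => by
    ext R
    have := key P Q R
    simp only [AddMonoidHom.mk'_apply, AddMonoidHom.add_apply]
    linarith

theorem polarHom_apply
    (par : ∀ P Q, H (P + Q) + H (P - Q) = 2 * (H P + H Q)) (P Q : G) : polarHom H par P Q = (H (P + Q) - H P - H Q) / 2 := rfl

theorem polarHom_self
    (par : ∀ P Q, H (P + Q) + H (P - Q) = 2 * (H P + H Q)) (P : G) : polarHom H par P P = H P := by
  have h0 := par 0 0
  have h1 := par P P
  simp only [add_zero, sub_self] at h0 h1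
  rw [polarHom_apply]
  linarith

/-- The Gram matrix of a family of elements for the polarization of `H`. -/
noncomputable def gramMatrix (H : G → ℝ) {ι : Type*} (P : ι → G) : Matrix ι ι ℝ :=
  Matrix.of fun i j => (H (P i + P j) - H (P i) - H (P j)) / 2

variable {ι : Type*} [Fintype ι]

theorem dotProduct_gramMatrix_intCast
    (par : ∀ P Q, H (P + Q) + H (P - Q) = 2 * (H P + H Q)) (P : ι → G) (n : ι → ℤ) :
    (fun i => (n i : ℝ)) ⬝ᵥ (gramMatrix H P *ᵥ fun i => (n i : ℝ)) = H (∑ i, n i • P i) := by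
  rw [← polarHom_self par, map_sum (polarHom H par), AddMonoidHom.finsetSum_apply]
  simp only [dotProduct, mulVec, map_sum, map_zsmul, AddMonoidHom.smul_apply, polarHom_apply,
    gramMatrix, Matrix.of_apply, zsmul_eq_mul]
  simp only [Finset.mul_sum]
  rw [Finset.sum_comm]
  refine Finset.sum_congr rfl fun i _ => Finset.sum_congr rfl fun j _ => ?_
  rw [add_comm (P i)]
  ring

/-- On integer vectors the form is a value of `H`. By homogeneity it is nonnegative on rational
vectors, and by continuity on real ones. -/
theorem posSemidef_gramMatrix
    (par : ∀ P Q, H (P + Q) + H (P - Q) = 2 * (H P + H Q)) (P : ι → G)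
    (hnonneg : ∀ Q, 0 ≤ H Q) : (gramMatrix H P).PosSemidef := by
  refine .of_dotProduct_mulVec_nonneg ?_ fun v => ?_
  · ext i j
    simp only [gramMatrix, conjTranspose_apply, Matrix.of_apply, star_trivial, add_comm (P j)]
    ring
  · simp only [star_trivial]
    have hcont : Continuous fun w : ι → ℝ => w ⬝ᵥ (gramMatrix H P *ᵥ w) := by
      unfold dotProduct mulVec dotProduct
      fun_prop
    have hlim : Tendsto (fun m : ℕ => fun i => ((⌊v i * (m : ℝ)⌋ : ℤ) : ℝ) / (m : ℝ)) atTop (𝓝 v) :=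
      tendsto_pi_nhds.mpr fun i =>
        tendsto_floor_mul_div (v i)
    refine ge_of_tendsto' ((hcont.tendsto v).comp hlim) fun m => ?_
    have h1 : (fun i => ((⌊v i * (m : ℝ)⌋ : ℤ) : ℝ) / (m : ℝ))
        = (m : ℝ)⁻¹ • fun i => ((⌊v i * (m : ℝ)⌋ : ℤ) : ℝ) := by
      ext i
      simp [div_eq_inv_mul]
    simp only [Function.comp_apply]
    rw [h1, mulVec_smul, dotProduct_smul, smul_dotProduct,
      dotProduct_gramMatrix_intCast par P fun i => ⌊v i * (m : ℝ)⌋]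
    have := hnonneg (∑ i, ⌊v i * (m : ℝ)⌋ • P i)
    simp only [smul_eq_mul]
    positivity

/-- A nonnegative quadratic function with the Northcott property has a positive definite Gram
matrix on every linearly independent family. -/
theorem posDef_gramMatrix
    (par : ∀ P Q, H (P + Q) + H (P - Q) = 2 * (H P + H Q)) (P : ι → G)
    (hnonneg : ∀ Q, 0 ≤ H Q) (hfin : ∀ b, {Q | H Q ≤ b}.Finite)
    (hP : LinearIndependent ℤ P) : (gramMatrix H P).PosDef := by
  have hpsd := posSemidef_gramMatrix par P hnonneg
  refine .of_dotProduct_mulVec_pos hpsd.isHermitian fun v hv => ?_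
  refine lt_of_le_of_ne (hpsd.dotProduct_mulVec_nonneg v) fun hzero => hv ?_
  have hker : gramMatrix H P *ᵥ v = 0 := (hpsd.dotProduct_mulVec_zero_iff v).mp hzero.symm
  have hker' : v ᵥ* gramMatrix H P = 0 := by
    rw [← mulVec_transpose, ← conjTranspose_eq_transpose_of_trivial, hpsd.isHermitian.eq, hker]
  let w (m : ℕ) (i : ι) : ℤ := ⌊v i * (m : ℝ)⌋
  set K : ℝ := ∑ i, ∑ j, |gramMatrix H P i j| with hK
  have hbound (m : ℕ) : H (∑ i, w m i • P i) ≤ K := by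
    rw [← dotProduct_gramMatrix_intCast par P (w m)]
    -- Since `v` lies in the kernel on both sides, only the fractional parts contribute, which
    -- bounds the form independently of `m`.
    have hw : (fun i => (w m i : ℝ)) = (m : ℝ) • v - fun i => Int.fract (v i * (m : ℝ)) := by
      ext i
      simp only [w, Pi.sub_apply, Pi.smul_apply, smul_eq_mul, Int.fract]
      ring
    rw [hw, mulVec_sub, mulVec_smul, hker, smul_zero, zero_sub, sub_dotProduct, smul_dotProduct,
      dotProduct_neg, dotProduct_mulVec, hker', zero_dotProduct, neg_zero, smul_zero, zero_sub,
      dotProduct_neg, neg_neg]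
    simp only [dotProduct, mulVec, Finset.mul_sum, hK]
    refine Finset.sum_le_sum fun i _ => Finset.sum_le_sum fun j _ => ?_
    refine (le_abs_self _).trans ?_
    rw [abs_mul, abs_mul, abs_of_nonneg (Int.fract_nonneg (v i * (m : ℝ))),
      abs_of_nonneg (Int.fract_nonneg (v j * (m : ℝ)))]
    have h1 := (Int.fract_lt_one (v i * (m : ℝ))).le
    have h2 := (Int.fract_lt_one (v j * (m : ℝ))).le
    have h3 := Int.fract_nonneg (v i * (m : ℝ))
    have h4 := Int.fract_nonneg (v j * (m : ℝ))
    have h5 := abs_nonneg (gramMatrix H P i j)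
    calc _ ≤ 1 * (|gramMatrix H P i j| * 1) := by gcongr
      _ = _ := by ring
  have hinj : Function.Injective fun n : ι → ℤ => ∑ i, n i • P i :=
    hP.fintypeLinearCombination_injective
  have hfinw : (Set.range w).Finite := by
    refine Set.Finite.of_finite_image (f := fun n : ι → ℤ => ∑ i, n i • P i)
      ((hfin K).subset ?_) hinj.injOn
    rintro _ ⟨_, ⟨m, rfl⟩, rfl⟩
    exact hbound m
  ext i
  have hfini : (Set.range fun m => |(w m i : ℝ)|).Finite := by
    refine (hfinw.image fun n : ι → ℤ => |(n i : ℝ)|).subset ?_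
    rintro _ ⟨m, rfl⟩
    exact ⟨w m, ⟨m, rfl⟩, rfl⟩
  obtain ⟨b, hb⟩ := hfini.bddAbove
  -- Finitely many vectors `w m` means bounded coordinates, whereas `w m i` grows like `m * v i`;
  -- hence `v i = 0`.
  have hb' (m : ℕ) : |v i| * m ≤ b + 1 := by
    have h1 : |(w m i : ℝ)| ≤ b := hb ⟨m, rfl⟩
    have h2 : |v i * (m : ℝ) - w m i| ≤ 1 := by
      rw [← Int.fract, abs_of_nonneg (Int.fract_nonneg _)]
      exact (Int.fract_lt_one _).le
    have h3 : |v i| * m = |v i * (m : ℝ)| := by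
      rw [abs_mul, Nat.abs_cast]
    rw [h3]
    calc _ = |(w m i : ℝ) + (v i * (m : ℝ) - w m i)| := by congr 1; ring
      _ ≤ _ := abs_add_le _ _
      _ ≤ _ := add_le_add h1 h2
  by_contra hvi
  have hpos : 0 < |v i| := abs_pos.mpr hvi
  obtain ⟨m, hm⟩ := exists_nat_gt ((b + 1) / |v i|)
  rw [div_lt_iff₀ hpos] at hm
  linarith [hb' m]

end Gram

end RankTwentyEight

namespace RankTwentyEight

open WeierstrassCurve WeierstrassCurve.Affine Height MvPolynomial

/-! ### Addition and subtraction on the symmetric square of the `x`-line. -/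

section AddSub

variable {F : Type*} [Field F] (W : WeierstrassCurve F)

theorem eval_addSubMap (x : Fin 3 → F) : (fun i => (addSubMap W i).eval x) =
    ![x 0 ^ 2 - W.b₄ * x 0 * x 2 - W.b₆ * x 1 * x 2 - W.b₈ * x 2 ^ 2,
      2 * x 1 * x 0 + W.b₂ * x 0 * x 2 + W.b₄ * x 1 * x 2 + W.b₆ * x 2 ^ 2,
      x 1 ^ 2 - 4 * x 0 * x 2] := by
  ext i
  fin_cases i <;> simp [addSubMap]

theorem eval_addSubMap_sym2x_self {x y : F} (h : W.toAffine.Nonsingular x y) :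
    (fun i => (addSubMap W i).eval ((Point.some x y h).sym2x (Point.some x y h))) =
      ![x ^ 4 - W.b₄ * x ^ 2 - 2 * W.b₆ * x - W.b₈, (y - W.toAffine.negY x y) ^ 2, 0] := by
  have e := (equation_iff ..).mp h.1
  rw [eval_addSubMap, Point.sym2x_some_some]
  ext i
  fin_cases i
  · simp
    ring
  · simp [negY, b₂, b₄, b₆]
    linear_combination (-4) * e
  · simp
    ring

variable [DecidableEq F]

theorem exists_smul_sym2x_add_sub_of_X_ne {x₁ y₁ x₂ y₂ : F}
    (h₁ : W.toAffine.Nonsingular x₁ y₁) (h₂ : W.toAffine.Nonsingular x₂ y₂) (hx : x₁ ≠ x₂) :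
    (fun i => (addSubMap W i).eval ((Point.some x₁ y₁ h₁).sym2x (Point.some x₂ y₂ h₂))) =
      (x₁ - x₂) ^ 2 • (Point.some x₁ y₁ h₁ + Point.some x₂ y₂ h₂).sym2x
        (Point.some x₁ y₁ h₁ - Point.some x₂ y₂ h₂) := by
  have hsub : x₁ - x₂ ≠ 0 := sub_ne_zero.mpr hx
  have e₁ := (equation_iff ..).mp h₁.1
  have e₂ := (equation_iff ..).mp h₂.1
  rw [eval_addSubMap, sub_eq_add_neg (Point.some x₁ y₁ h₁), Point.neg_some, Point.add_of_X_ne hx, Point.add_of_X_ne hx,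
    Point.sym2x_some_some, Point.sym2x_some_some, slope_of_X_ne hx, slope_of_X_ne hx]
  simp only [addX, negY, b₂, b₄, b₆, b₈]
  ext i
  fin_cases i
  · simp
    field_simp
    set E₁ := y₁ ^ 2 + W.a₁ * x₁ * y₁ + W.a₃ * y₁ with hE₁
    set E₂ := y₂ ^ 2 + W.a₁ * x₂ * y₂ + W.a₃ * y₂ with hE₂
    set c₁ := x₁ ^ 3 + W.a₂ * x₁ ^ 2 + W.a₄ * x₁ + W.a₆ with hc₁
    set c₂ := x₂ ^ 3 + W.a₂ * x₂ ^ 2 + W.a₄ * x₂ + W.a₆ with hc₂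
    set L₁ := W.a₁ * x₁ + W.a₃ with hL₁
    set L₂ := W.a₁ * x₂ + W.a₃ with hL₂
    set S := (W.a₂ + x₁ + x₂) * (x₁ - x₂) ^ 2 with hS
    linear_combination (norm := (simp only [hE₁, hE₂, hc₁, hc₂, hL₁, hL₂, hS]; ring1))
      -(E₁ + c₁ + 2 * E₂ - 2 * S + L₁ * L₂ - 4 * E₂ - L₂ ^ 2) * e₁
      - (E₂ + c₂ + 2 * c₁ - 2 * S + L₁ * L₂ - 4 * c₁ - L₁ ^ 2) * e₂
  · simp
    field_simp
    linear_combination -2 * e₁ - 2 * e₂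
  · simp
    ring

/-- The scalar is `(y - negY)²` unless the point is 2-torsion. In that case it is the quartic in
`x`, which is nonzero because the forms have no common zero on an elliptic curve. -/
theorem exists_smul_sym2x_add_self [W.IsElliptic] {x y : F} (h : W.toAffine.Nonsingular x y) :
    ∃ c : F, c ≠ 0 ∧
      (fun i => (addSubMap W i).eval ((Point.some x y h).sym2x (Point.some x y h))) =
      c • (Point.some x y h + Point.some x y h).sym2x 0 := by
  have hne := addSubMap_ne_zero W (Point.sym2x_ne_zero (Point.some x y h) (Point.some x y h))
  rw [eval_addSubMap_sym2x_self] at hne ⊢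
  by_cases hy : y = W.toAffine.negY x y
  · rw [Point.add_self_of_Y_eq hy, Point.sym2x_zero_zero]
    rw [← hy, sub_self] at hne ⊢
    refine ⟨x ^ 4 - W.b₄ * x ^ 2 - 2 * W.b₆ * x - W.b₈, fun h0 => hne ?_, ?_⟩
    · rw [h0]
      ext i
      fin_cases i <;> simp
    · ext i
      fin_cases i <;> simp
  · have hy' : y - W.toAffine.negY x y ≠ 0 := sub_ne_zero.mpr hy
    refine ⟨(y - W.toAffine.negY x y) ^ 2, pow_ne_zero 2 hy', ?_⟩
    have e := (equation_iff ..).mp h.1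
    rw [Point.add_self_of_Y_ne hy, Point.sym2x_some_zero, slope_of_Y_ne rfl hy]
    ext i
    fin_cases i
    · have hclear (M ψ : F) (hψ : ψ ≠ 0) : ψ ^ 2 * ((M / ψ) ^ 2 + W.a₁ * (M / ψ) - W.a₂ - x - x)
          = M ^ 2 + W.a₁ * M * ψ - (W.a₂ + 2 * x) * ψ ^ 2 := by
        field_simp
        ring
      simp only [addX, Matrix.smul_cons, smul_eq_mul, Fin.zero_eta, Matrix.cons_val_zero]
      rw [hclear _ _ hy']
      simp only [negY, b₄, b₆, b₈]
      linear_combination (W.a₁ ^ 2 + 4 * W.a₂ + 8 * x) * e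
    · simp
    · simp

/-- The map `addSubMap` describes addition and subtraction on the symmetric square of the
`x`-line, up to scaling. -/
theorem exists_smul_sym2x_add_sub [W.IsElliptic] (P Q : W.toAffine.Point) :
    ∃ c : F, c ≠ 0 ∧
      (fun i => (addSubMap W i).eval (P.sym2x Q)) = c • (P + Q).sym2x (P - Q) := by
  match P, Q with
  | 0, 0 =>
    refine ⟨1, one_ne_zero, ?_⟩
    rw [eval_addSubMap, add_zero, sub_zero, Point.sym2x_zero_zero]
    ext i
    fin_cases i <;> simp
  | .some x y h, 0 =>
    refine ⟨1, one_ne_zero, ?_⟩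
    rw [eval_addSubMap, add_zero, sub_zero, Point.sym2x_some_zero, Point.sym2x_some_some]
    ext i
    fin_cases i <;> simp <;> ring
  | 0, .some x y h =>
    refine ⟨1, one_ne_zero, ?_⟩
    rw [eval_addSubMap, zero_add, zero_sub, Point.sym2x_neg_right, Point.sym2x_zero_some,
      Point.sym2x_some_some]
    ext i
    fin_cases i <;> simp <;> ring
  | .some x₁ y₁ h₁, .some x₂ y₂ h₂ =>
    by_cases hx : x₁ = x₂
    · rcases Point.X_eq_iff.mp hx with hPQ | hPQ
      · rw [← hPQ, sub_self]
        exact exists_smul_sym2x_add_self W h₁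
      · have h3 : Point.some x₂ y₂ h₂ = -Point.some x₁ y₁ h₁ := by rw [hPQ, neg_neg]
        rw [h3, Point.sym2x_neg_right, sub_neg_eq_add, add_neg_cancel, Point.sym2x_comm 0]
        exact exists_smul_sym2x_add_self W h₁
    · exact ⟨_, pow_ne_zero 2 (sub_ne_zero.mpr hx),
        exists_smul_sym2x_add_sub_of_X_ne W h₁ h₂ hx⟩

end AddSub

/-! ### Naive height: approximate parallelogram law and Northcott finiteness. -/

theorem naiveHeight_eq_logHeight_xRep {W : WeierstrassCurve.Affine ℚ} (P : W.Point) :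
    naiveHeight P = logHeight P.xRep := by
  match P with
  | 0 =>
    have := logHeight₁_div_eq_logHeight (1 : ℚ) 0
    simp only [div_zero, logHeight₁_zero] at this
    exact this
  | .some x y h => simp [naiveHeight, logHeight₁_eq_logHeight]

theorem naiveHeight_nonneg {W : WeierstrassCurve.Affine ℚ} (P : W.Point) : 0 ≤ naiveHeight P := by
  match P with
  | .zero => exact le_rfl
  | .some x y h => exact zero_le_logHeight₁ x

/-- The approximate parallelogram law for the naive height on an elliptic curve over `ℚ`. -/
theorem exists_abs_naiveHeight_add_sub_le (W : WeierstrassCurve ℚ) [W.IsElliptic] :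
    ∃ C, ∀ P Q : W.toAffine.Point,
      |naiveHeight (P + Q) + naiveHeight (P - Q) - 2 * (naiveHeight P + naiveHeight Q)| ≤ C := by
  obtain ⟨C₁, hC₁⟩ := abs_logHeight_addSubMap_sub_two_mul_logHeight_le W
  obtain ⟨C₂, hC₂⟩ := abs_logHeight_sym2_sub_le ℚ
  have hsym (P Q : W.toAffine.Point) :
      |logHeight (P.sym2x Q) - (naiveHeight P + naiveHeight Q)| ≤ C₂ := by
    have hv (v : Fin 2 → ℚ) : v = ![v 0, v 1] := by
      ext i
      fin_cases i <;> rfl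
    have h1 := P.xRep_ne_zero
    have h2 := Q.xRep_ne_zero
    rw [naiveHeight_eq_logHeight_xRep, naiveHeight_eq_logHeight_xRep]
    rw [hv P.xRep] at h1 ⊢
    rw [hv Q.xRep] at h2 ⊢
    exact hC₂ h1 h2
  -- The comparison `hsym` is used once for `P + Q`, `P - Q` and with weight two for `P`, `Q`.
  refine ⟨C₁ + 3 * C₂, fun P Q => ?_⟩
  obtain ⟨c, hc, h⟩ := exists_smul_sym2x_add_sub W P Q
  have h1 := hC₁ (P.sym2x Q)
  rw [h, logHeight_smul_eq_logHeight _ hc] at h1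
  have h2 := hsym P Q
  have h3 := hsym (P + Q) (P - Q)
  rw [abs_le] at *
  constructor <;> linarith

theorem finite_naiveHeight_le {W : WeierstrassCurve.Affine ℚ} (b : ℝ) :
    {P : W.Point | naiveHeight P ≤ b}.Finite := by
  have hx := NumberField.finite_setOfPred_logHeight₁_le ℚ b
  have hfib (v : Fin 2 → ℚ) : {P : W.Point | P.xRep = v}.Finite := by
    rcases Set.eq_empty_or_nonempty {P : W.Point | P.xRep = v} with h | ⟨P, hP⟩
    · rw [h]
      exact Set.finite_empty
    · refine ({P, -P} : Set W.Point).toFinite.subset fun Q hQ => ?_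
      exact Point.eq_or_eq_neg_of_xRep_eq_xRep (hQ.trans hP.symm)
  refine (((hx.image fun x => ![x, 1]).insert ![1, 0]).biUnion fun v _ => hfib v).subset
    fun P hP => ?_
  simp only [Set.mem_iUnion]
  refine ⟨P.xRep, ?_, rfl⟩
  match P with
  | .zero => exact Set.mem_insert _ _
  | .some x y h => exact Set.mem_insert_of_mem _ ⟨x, hP, rfl⟩

/-! ### Canonical height and regulator. -/

section Canonical

variable (W : WeierstrassCurve ℚ) [W.IsElliptic]

theorem tendsto_canonicalHeight (P : W.toAffine.Point) :
    Filter.Tendsto (fun n : ℕ => naiveHeight ((2 ^ n : ℕ) • P) / (4 : ℝ) ^ n) Filter.atTop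
      (𝓝 (canonicalHeight P)) := by
  obtain ⟨C, hC⟩ := exists_abs_naiveHeight_add_sub_le W
  obtain ⟨a, ha, -⟩ := exists_tendsto_div_four_pow hC P
  exact tendsto_nhds_limUnder ⟨a, ha⟩

theorem canonicalHeight_parallelogram (P Q : W.toAffine.Point) :
    canonicalHeight (P + Q) + canonicalHeight (P - Q)
      = 2 * (canonicalHeight P + canonicalHeight Q) := by
  obtain ⟨C, hC⟩ := exists_abs_naiveHeight_add_sub_le W
  exact parallelogram_of_tendsto hC (tendsto_canonicalHeight W) P Q

theorem canonicalHeight_nonneg (P : W.toAffine.Point) : 0 ≤ canonicalHeight P :=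
  ge_of_tendsto' (tendsto_canonicalHeight W P)
    fun _ => div_nonneg (naiveHeight_nonneg _) (by positivity)

theorem finite_canonicalHeight_le (b : ℝ) :
    {P : W.toAffine.Point | canonicalHeight P ≤ b}.Finite := by
  obtain ⟨C, hC⟩ := exists_abs_naiveHeight_add_sub_le W
  refine (finite_naiveHeight_le (b + (C + |naiveHeight (0 : W.toAffine.Point)|) / 4 /
    (1 - 1 / 4))).subset fun P (hP : canonicalHeight P ≤ b) => ?_
  obtain ⟨a, ha, hle⟩ := exists_tendsto_div_four_pow hC P
  rw [tendsto_nhds_unique ha (tendsto_canonicalHeight W P)] at hle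
  have := le_abs_self (naiveHeight P - canonicalHeight P)
  simp only [Set.mem_ofPred_eq]
  linarith

/-- The regulator of a linearly independent family of rational points is positive. -/
theorem regulator_pos {r : ℕ} {P : Fin r → W.toAffine.Point} (hP : LinearIndependent ℤ P) :
    0 < regulator P :=
  (posDef_gramMatrix (canonicalHeight_parallelogram W) P (canonicalHeight_nonneg W)
    (finite_canonicalHeight_le W) hP).det_pos

end Canonical

end RankTwentyEight

namespace RankTwentyEight

open WeierstrassCurve WeierstrassCurve.Affine Polynomial

/-! ### Infinite descent on the coefficients of a relation. -/

section Independence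

variable {G : Type*} [AddCommGroup G] {ι : Type*} [Fintype ι]

/-- In a group without `2`-torsion, a family all of whose linear relations have even coefficients
is linearly independent. -/
theorem linearIndependent_of_forall_even (htors : ∀ Q : G, Q + Q = 0 → Q = 0) {P : ι → G}
    (heven : ∀ n : ι → ℤ, ∑ i, n i • P i = 0 → ∀ i, Even (n i)) : LinearIndependent ℤ P := by
  have hpow (k : ℕ) : ∀ n : ι → ℤ, ∑ i, n i • P i = 0 → ∀ i, 2 ^ k ∣ n i := by
    induction k with
    | zero => simp
    | succ k ih =>
      intro n hn i
      choose m hm using heven n hn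
      have hm0 : ∑ i, m i • P i = 0 := by
        refine htors _ ?_
        rw [← Finset.sum_add_distrib, ← hn]
        exact Finset.sum_congr rfl fun j _ => by rw [hm j, add_smul]
      rw [hm i, ← two_mul, pow_succ']
      exact mul_dvd_mul_left 2 (ih m hm0 i)
  refine Fintype.linearIndependent_iff.mpr fun n hn i => ?_
  refine Int.eq_zero_of_dvd_of_natAbs_lt_natAbs (hpow (n i).natAbs n hn i) ?_
  rw [Int.natAbs_pow]
  exact Nat.lt_two_pow_self

end Independence

/-! ### The descent homomorphism to square classes. -/

section SquareClass

variable {F : Type*} [Field F] {W : WeierstrassCurve.Affine F}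
  {L : Type*} [Field L] (f : F →+* L) (θ : L)

/-- A representative of the square class of `x(P) - θ`. -/
def xSub : W.Point → L
  | .zero => 1
  | .some x _ _ => f x - θ

theorem xSub_zero : xSub f θ (0 : W.Point) = 1 := rfl

variable {f θ}

theorem xSub_ne_zero (hne : ∀ x, f x ≠ θ) (P : W.Point) : xSub f θ P ≠ 0 :=
  match P with
  | .zero => one_ne_zero
  | .some x _ _ => sub_ne_zero.mpr (hne x)

/-- The line through the two points meets the curve at the abscissas `x₁, x₂, x₃`. Restricting the
curve equation to this line and evaluating at θ gives the product of the `xᵢ - θ`; it is a square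
because θ is the abscissa of a 2-torsion point. -/
theorem isSquare_xSub_add [DecidableEq F] (h2 : (2 : L) ≠ 0)
    (hθ : 4 * θ ^ 3 + f W.b₂ * θ ^ 2 + 2 * f W.b₄ * θ + f W.b₆ = 0) (P Q : W.Point) :
    IsSquare (xSub f θ (P + Q) * (xSub f θ P * xSub f θ Q)) := by
  match P, Q with
  | 0, Q => simp [xSub_zero]
  | .some x y h, 0 => simp [xSub_zero]
  | .some x₁ y₁ h₁, .some x₂ y₂ h₂ =>
    by_cases hxy : x₁ = x₂ ∧ y₁ = W.negY x₂ y₂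
    · rw [Point.add_of_Y_eq hxy.1 hxy.2, xSub_zero, one_mul]
      obtain ⟨rfl, -⟩ := hxy
      exact ⟨_, rfl⟩
    · rw [Point.add_some hxy]
      simp only [xSub]
      have h := congrArg (Polynomial.eval₂ f θ) (addPolynomial_slope h₁.1 h₂.1 hxy)
      rw [addPolynomial_eq] at h
      set ℓ := W.slope x₁ x₂ y₁ y₂ with hℓ
      set x₃ := W.addX x₁ x₂ ℓ with hx₃
      simp only [Cubic.toPoly, eval₂_neg, eval₂_add, eval₂_mul, eval₂_C, eval₂_pow, eval₂_X,
        eval₂_sub, eval₂_one, eval₂_ofNat, map_add, map_sub, map_mul, map_neg, map_pow, map_one, map_ofNat] at h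
      -- The ordinate of the 2-torsion point over θ; the square root below is `η` minus the value of
      -- the line at θ.
      obtain ⟨η, hη⟩ : ∃ η : L, 2 * η + (f W.a₁ * θ + f W.a₃) = 0 :=
        ⟨-(f W.a₁ * θ + f W.a₃) / 2, by field_simp; ring⟩
      have hη₂ : θ ^ 3 + f W.a₂ * θ ^ 2 + f W.a₄ * θ + f W.a₆
          = η ^ 2 + (f W.a₁ * θ + f W.a₃) * η := by
        simp only [b₂, b₄, b₆, map_add, map_mul, map_pow, map_ofNat] at hθ
        refine mul_left_cancel₀ (mul_ne_zero h2 h2) ?_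
        linear_combination hθ - (f W.a₁ * θ + f W.a₃ + 2 * η) * hη
      refine ⟨η - (f ℓ * (θ - f x₁) + f y₁), ?_⟩
      linear_combination -h + (f ℓ * (θ - f x₁) + f y₁ - η) * hη - hη₂

/-- The homomorphism `P ↦ x(P) - θ` to the square classes of `L`. -/
noncomputable def squareClassHom [DecidableEq F] (h2 : (2 : L) ≠ 0)
    (hθ : 4 * θ ^ 3 + f W.b₂ * θ ^ 2 + 2 * f W.b₄ * θ + f W.b₆ = 0) (hne : ∀ x, f x ≠ θ) :
    W.Point →+ Additive (Lˣ ⧸ (powMonoidHom 2 : Lˣ →* Lˣ).range) :=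
  AddMonoidHom.mk' (fun P : W.Point => Additive.ofMul
    (QuotientGroup.mk (Units.mk0 (xSub f θ P) (xSub_ne_zero hne P)) :
      Lˣ ⧸ (powMonoidHom 2 : Lˣ →* Lˣ).range)) fun P Q => by
  rw [← ofMul_mul, ← QuotientGroup.mk_mul]
  refine congrArg Additive.ofMul ?_
  obtain ⟨s, hs⟩ := isSquare_xSub_add h2 hθ P Q
  have hP := xSub_ne_zero hne P
  have hQ := xSub_ne_zero hne Q
  have hPQ := xSub_ne_zero hne (P + Q)
  have hs0 : s ≠ 0 := by
    rintro rfl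
    exact mul_ne_zero hPQ (mul_ne_zero hP hQ) (by rw [hs, mul_zero])
  refine QuotientGroup.eq.mpr ⟨Units.mk0 s hs0 / Units.mk0 _ hPQ, ?_⟩
  ext
  simp only [powMonoidHom_apply, Units.val_pow_eq_pow_val, Units.val_div_eq_div_val, Units.val_mk0,
    Units.val_mul, Units.val_inv_eq_inv_val]
  rw [div_pow, sq s, ← hs]
  field_simp

end SquareClass

/-! ### Local quadratic characters and relations modulo 2. -/

section Padic

theorem negOnePow_sum {ι : Type*} (s : Finset ι) (m : ι → ℤ) :
    (∑ i ∈ s, m i).negOnePow = ∏ i ∈ s, (m i).negOnePow := by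
  classical
  induction s using Finset.induction_on with
  | empty => simp
  | insert i s hi ih => rw [Finset.sum_insert hi, Finset.prod_insert hi, Int.negOnePow_add, ih]

variable {p : ℕ} [hp : Fact p.Prime]

theorem toZMod_eq_intCast_iff (z : ℤ_[p]) (r : ℤ) :
    PadicInt.toZMod z = (r : ZMod p) ↔ ‖z - r‖ < 1 := by
  rw [← sub_eq_zero, ← map_intCast (PadicInt.toZMod (p := p)) r, ← map_sub, ← RingHom.mem_ker,
    PadicInt.ker_toZMod, IsLocalRing.mem_maximalIdeal, PadicInt.mem_nonunits]

/-- A simple root modulo `p` of an integer polynomial lifts to a `p`-adic root. -/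
theorem exists_padicInt_root (g : ℤ[X]) (r : ℤ) (hr : (p : ℤ) ∣ g.eval r)
    (hr' : ¬ (p : ℤ) ∣ g.derivative.eval r) :
    ∃ z : ℤ_[p], aeval z g = 0 ∧ PadicInt.toZMod z = (r : ZMod p) := by
  have heval (q : ℤ[X]) : aeval (r : ℤ_[p]) q = ((q.eval r : ℤ) : ℤ_[p]) := by
    simpa using aeval_algebraMap_apply ℤ_[p] r q
  have h1 : ‖aeval (r : ℤ_[p]) g‖ < 1 := by
    rw [heval]
    exact PadicInt.norm_intCast_lt_one_iff.mpr hr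
  have h2 : ‖aeval (r : ℤ_[p]) g.derivative‖ = 1 := by
    rw [heval]
    exact le_antisymm (PadicInt.norm_le_one _)
      (not_lt.mp fun h => hr' (PadicInt.norm_intCast_lt_one_iff.mp h))
  obtain ⟨z, hz, hz', -⟩ := hensels_lemma (F := g) (a := (r : ℤ_[p])) (by rw [h2, one_pow]; exact h1)
  exact ⟨z, hz, (toZMod_eq_intCast_iff z r).mpr (h2 ▸ hz')⟩

/-- The quadratic character of the residue field, on `p`-adic units. -/
noncomputable def unitChar (p : ℕ) [Fact p.Prime] : ℤ_[p]ˣ →* ℤˣ :=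
  (quadraticChar (ZMod p)).toUnitHom.comp (Units.map (PadicInt.toZMod (p := p)).toMonoidHom)

/-- A square root of a unit has norm 1, so it is itself a unit and its character value gets squared.
-/
theorem unitChar_eq_one_of_coe_eq_sq (u : ℤ_[p]ˣ) (w : ℚ_[p]) (h : ((u : ℤ_[p]) : ℚ_[p]) = w ^ 2) :
    unitChar p u = 1 := by
  have hw : ‖w‖ = 1 := by
    have h1 : ‖w‖ ^ 2 = 1 := by
      rw [← norm_pow, ← h, PadicInt.padic_norm_e_of_padicInt, PadicInt.norm_units]
    exact (pow_eq_one_iff_of_nonneg (norm_nonneg w) two_ne_zero).mp h1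
  have hu : u = PadicInt.mkUnits hw ^ 2 := by
    refine Units.ext (Subtype.ext ?_)
    rw [h, Units.val_pow_eq_pow_val, PadicInt.coe_pow, PadicInt.mkUnits_eq]
  rw [hu, map_pow, Int.units_sq]

variable {W : WeierstrassCurve.Affine ℚ} {ι : Type*} [Fintype ι]

/-- A relation between points with integral `x`-coordinates is a relation modulo `2` between
the quadratic characters of `x - r`, for `r` a simple root modulo `p` of the `2`-division
polynomial. -/
theorem even_sum_of_sum_smul_eq_zero {B₂ B₄ B₆ : ℤ} (hB₂ : W.b₂ = B₂) (hB₄ : W.b₄ = B₄)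
    (hB₆ : W.b₆ = B₆) (hroot : ∀ x : ℚ, 4 * x ^ 3 + W.b₂ * x ^ 2 + 2 * W.b₄ * x + W.b₆ ≠ 0)
    {r : ℤ} (hr : (p : ℤ) ∣ 4 * r ^ 3 + B₂ * r ^ 2 + 2 * B₄ * r + B₆)
    (hr' : ¬ (p : ℤ) ∣ 12 * r ^ 2 + 2 * B₂ * r + 2 * B₄)
    {P : ι → W.Point} {x : ι → ℤ} (hx : ∀ i, ∃ y h, P i = .some (x i : ℚ) y h)
    {c : ι → ℤ} (hc : ∀ i, quadraticChar (ZMod p) ((x i : ZMod p) - r) = (c i).negOnePow)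
    (n : ι → ℤ) (hn : ∑ i, n i • P i = 0) : Even (∑ i, n i * c i) := by
  obtain ⟨θ, hθ, hθr⟩ := exists_padicInt_root (p := p)
    (C 4 * X ^ 3 + C B₂ * X ^ 2 + C 2 * C B₄ * X + C B₆) r (by simpa using hr) (by
      convert! hr' using 2
      simp
      ring)
  have hθ' : 4 * (θ : ℚ_[p]) ^ 3 + algebraMap ℚ ℚ_[p] W.b₂ * (θ : ℚ_[p]) ^ 2
      + 2 * algebraMap ℚ ℚ_[p] W.b₄ * (θ : ℚ_[p]) + algebraMap ℚ ℚ_[p] W.b₆ = 0 := by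
    simp only [map_add, map_mul, map_pow, aeval_C, aeval_X] at hθ
    have := congrArg (fun z : ℤ_[p] => (z : ℚ_[p])) hθ
    have h2 : ((2 : ℤ_[p]) : ℚ_[p]) = 2 := map_ofNat PadicInt.Coe.ringHom 2
    have h4 : ((4 : ℤ_[p]) : ℚ_[p]) = 4 := map_ofNat PadicInt.Coe.ringHom 4
    simpa [hB₂, hB₄, hB₆, h2, h4] using this
  have hne (q : ℚ) : algebraMap ℚ ℚ_[p] q ≠ θ := fun h => hroot q <| by
    rw [← h] at hθ'
    refine (algebraMap ℚ ℚ_[p]).injective ?_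
    simpa using hθ'
  -- The prescribed character values are signs, hence nonzero, so `x i` and θ differ modulo `p`.
  have hunit (i : ι) : IsUnit ((x i : ℤ_[p]) - θ) := by
    rw [PadicInt.isUnit_iff]
    refine le_antisymm (PadicInt.norm_le_one _) (not_lt.mp fun h => ?_)
    rw [norm_sub_rev, ← toZMod_eq_intCast_iff, hθr] at h
    have h1 := hc i
    rw [h, sub_self, quadraticChar_zero] at h1
    exact (c i).negOnePow.ne_zero h1.symm
  choose u hu using hunit
  have hxu (i : ι) : xSub (algebraMap ℚ ℚ_[p]) (θ : ℚ_[p]) (P i) = ((u i : ℤ_[p]) : ℚ_[p]) := by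
    obtain ⟨y, h, hi⟩ := hx i
    rw [hi, hu]
    simp [xSub]
  have hmap := congrArg (squareClassHom (two_ne_zero) hθ' hne) hn
  rw [map_sum, map_zero] at hmap
  simp only [map_zsmul] at hmap
  let j : ℤ_[p]ˣ →* ℚ_[p]ˣ := Units.map (PadicInt.Coe.ringHom (p := p)).toMonoidHom
  have hj (i : ι) : squareClassHom (two_ne_zero) hθ' hne (P i)
      = (QuotientGroup.mk' (powMonoidHom 2 : ℚ_[p]ˣ →* ℚ_[p]ˣ).range).toAdditive
        (Additive.ofMul (j (u i))) := by
    refine congrArg (fun v => Additive.ofMul (QuotientGroup.mk v)) ?_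
    ext
    exact hxu i
  simp only [hj, ← map_zsmul, ← map_sum, ← ofMul_zpow, ← ofMul_prod, ← map_zpow, ← map_prod] at hmap
  obtain ⟨w, hw⟩ := (QuotientGroup.eq_one_iff _).mp (Additive.ofMul.injective hmap)
  have hchar := unitChar_eq_one_of_coe_eq_sq (∏ i, u i ^ n i) (w : ℚ_[p])
    (congrArg Units.val hw).symm
  have hui (i : ι) : unitChar p (u i) = (c i).negOnePow := by
    ext
    rw [← hc i, unitChar, MonoidHom.comp_apply, MulChar.coe_toUnitHom, Units.coe_map]
    simp [hu, hθr]
  rw [← Int.negOnePow_eq_one_iff, ← hchar, map_prod]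
  simp only [map_zpow, hui]
  rw [negOnePow_sum]
  exact Finset.prod_congr rfl fun i _ => by
    rw [Int.negOnePow_def, Int.negOnePow_def, ← zpow_mul, mul_comm]

end Padic

end RankTwentyEight

/-! ### The explicit curve, its points and the numerical certificate. -/

namespace RankTwentyEight

open WeierstrassCurve WeierstrassCurve.Affine

theorem curve_b₂ : curve.b₂ = (-3 : ℤ) := by
  norm_num [WeierstrassCurve.b₂, curve]

theorem curve_b₄ : curve.b₄ = (-40135524831151053170066416418677085501860460624357913003 : ℤ) := by
  norm_num [WeierstrassCurve.b₄, curve]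

theorem curve_b₆ : curve.b₆ = (137926447180122225868131942761562881499423777437276721445064033185167757794928973717 : ℤ) := by
  norm_num [WeierstrassCurve.b₆, curve]

instance curve_isElliptic : curve.IsElliptic where
  isUnit := by
    refine IsUnit.mk0 _ ?_
    norm_num [WeierstrassCurve.Δ, WeierstrassCurve.b₂, WeierstrassCurve.b₄, WeierstrassCurve.b₆,
      WeierstrassCurve.b₈, curve]

/-- The `2`-division polynomial of the curve has no rational root. -/
theorem twoDivision_ne_zero (x : ℚ) :
    4 * x ^ 3 + curve.b₂ * x ^ 2 + 2 * curve.b₄ * x + curve.b₆ ≠ 0 := by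
  rw [curve_b₂, curve_b₄, curve_b₆]
  intro h
  -- Multiplying the cubic by 16 makes it monic in `4 * x`; a rational root then gives an integer
  -- root, excluded modulo 23.
  have hint : _root_.IsIntegral ℤ (4 * x) := by
    refine ⟨Polynomial.X ^ 3 + Polynomial.C (-3) * Polynomial.X ^ 2
      + Polynomial.C (8 * -40135524831151053170066416418677085501860460624357913003) * Polynomial.X
      + Polynomial.C (16 * 137926447180122225868131942761562881499423777437276721445064033185167757794928973717), ?_, ?_⟩
    · monicity!
    · simp only [Polynomial.eval₂_add, Polynomial.eval₂_mul, Polynomial.eval₂_pow,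
        Polynomial.eval₂_X, Polynomial.eval₂_C]
      simp only [eq_intCast]
      push_cast at h ⊢
      linear_combination 16 * h
  obtain ⟨z, hz⟩ := IsIntegrallyClosed.isIntegral_iff.mp hint
  have hx : x = z / 4 := by
    rw [eq_intCast] at hz
    rw [hz]
    ring
  have hZ : z ^ 3 + (-3) * z ^ 2 + 8 * (-40135524831151053170066416418677085501860460624357913003) * z
      + 16 * 137926447180122225868131942761562881499423777437276721445064033185167757794928973717 = 0 := by
    rw [hx] at h
    have h16 : ((z ^ 3 + (-3) * z ^ 2 + 8 * (-40135524831151053170066416418677085501860460624357913003) * z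
      + 16 * 137926447180122225868131942761562881499423777437276721445064033185167757794928973717 : ℤ) : ℚ) = 0 := by
      push_cast at h ⊢
      linear_combination 16 * h
    exact_mod_cast h16
  have h23 := congrArg (fun t : ℤ => (t : ZMod 23)) hZ
  simp only [Int.cast_add, Int.cast_mul, Int.cast_pow] at h23
  have hall : ∀ t : ZMod 23, t ^ 3 + ((-3 : ℤ) : ZMod 23) * t ^ 2
      + ((8 : ℤ) : ZMod 23) * ((-40135524831151053170066416418677085501860460624357913003 : ℤ) : ZMod 23) * t
      + ((16 : ℤ) : ZMod 23) * ((137926447180122225868131942761562881499423777437276721445064033185167757794928973717 : ℤ) : ZMod 23) ≠ ((0 : ℤ) : ZMod 23) := by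
    decide +kernel
  exact hall _ h23

theorem eq_zero_of_add_self_eq_zero (Q : curve.toAffine.Point) (hQ : Q + Q = 0) : Q = 0 := by
  match Q with
  | 0 => rfl
  | .some x y h =>
    exfalso
    by_cases hy : y = curve.toAffine.negY x y
    · have e := (equation_iff ..).mp h.1
      have hy' : 2 * y + curve.a₁ * x + curve.a₃ = 0 := by
        rw [negY] at hy
        linear_combination hy
      refine twoDivision_ne_zero x ?_
      simp only [WeierstrassCurve.b₂, WeierstrassCurve.b₄, WeierstrassCurve.b₆]
      linear_combination (2 * y + curve.a₁ * x + curve.a₃) * hy' - 4 * e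
    · rw [Point.add_self_of_Y_ne hy] at hQ
      exact Point.some_ne_zero _ hQ

/-- The `x`-coordinates of Elkies' independent points. -/
def pointX : Fin 28 → ℤ := ![
    -2124150091254381073292137463, 2334509866034701756884754537,
    -1671736054062369063879038663, 2139130260139156666492982137,
    1534706764467120723885477337, -2731079487875677033341575063,
    2775726266844571649705458537, 1494385729327188957541833817,
    1868438228620887358509065257, 2008945108825743774866542537,
    2348360540918025169651632937, -1472084007090481174470008663,
    2924128607708061213363288937, 5374993891066061893293934537,
    1709690768233354523334008557, 2450954011353593144072595187,
    2969254709273559167464674937, 2711914934941692601332882937,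
    20078586077996854528778328937, 2158082450240734774317810697,
    2004645458247059022403224937, 2975749450947996264947091337,
    -2102490467686285150147347863, 311583179915063034902194537,
    2773931008341865231443771817, 2156581188143768409363461387,
    3866330499872412508815659137, 2230868289773576023778678737]

/-- The `y`-coordinates of Elkies' independent points. -/
def pointY : Fin 28 → ℤ := ![
    259854492051899599030515511070780628911531, 18872004195494469180868316552803627931531,
    251709377261144287808506947241319126049131, 36639509171439729202421459692941297527531,
    85429585346017694289021032862781072799531, 262521815484332191641284072623902143387531,
    12845755474014060248869487699082640369931, 88486605527733405986116494514049233411451,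
    59237403214437708712725140393059358589131, 47690677880125552882151750781541424711531,
    17492930006200557857340332476448804363531, 246643450653503714199947441549759798469131,
    28350264431488878501488356474767375899531, 286188908427263386451175031916479893731531,
    71898834974686089466159700529215980921631, 4445228173532634357049262550610714736531,
    32766893075366270801333682543160469687531, 2068436612778381698650413981506590613531,
    2779608541137806604656051725624624030091531, 34994373401964026809969662241800901254731,
    48049329780704645522439866999888475467531, 33398989826075322320208934410104857869131,
    259576391459875789571677393171687203227531, 168104385229980603540109472915660153473931,
    12632162834649921002414116273769275813451, 35125092964022908897004150516375178087331,
    121197755655944226293036926715025847322531, 28558760030597485663387020600768640028531]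

theorem equation_pointX_pointY (i : Fin 28) :
    curve.toAffine.Equation (pointX i : ℚ) (pointY i : ℚ) := by
  have h : ∀ i, pointY i ^ 2 + pointX i * pointY i + pointY i = pointX i ^ 3 - pointX i ^ 2
      - 20067762415575526585033208209338542750930230312178956502 * pointX i
      + 34481611795030556467032985690390720374855944359319180361266008296291939448732243429 := by
    decide +kernel
  rw [equation_iff]
  have := congrArg (fun t : ℤ => (t : ℚ)) (h i)
  simp only [curve]
  push_cast at this
  linear_combination this

/-- Elkies' independent points. -/
noncomputable def elkiesPoint (i : Fin 28) : curve.toAffine.Point :=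
  .some _ _ (equation_iff_nonsingular.mp (equation_pointX_pointY i))

/-- The primes whose quadratic characters separate the points modulo `2`. -/
def charPrime : Fin 28 → ℕ := ![
    -- A prime occurs twice when two of its roots supply separate characters.
    41, 41, 43, 59, 59, 67, 83, 101, 103, 107, 131, 131, 137, 137,
    139, 157, 163, 173, 181, 193, 197, 211, 211, 227, 229, 239, 251, 251]

/-- A root of the `2`-division polynomial modulo each of the primes. -/
def charRoot : Fin 28 → ℤ := ![
    14, 31, 2, 25, 27, 25, 51, 22, 10, 79, 40, 70, 115, 120,
    10, 42, 71, 17, 80, 165, 91, 13, 50, 67, 206, 37, 31, 197]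

/-- The matrix with a given bit mask for each row. -/
def bitMatrix (mask : Fin 28 → ℕ) : Matrix (Fin 28) (Fin 28) (ZMod 2) :=
  Matrix.of fun i j => if (mask i).testBit j then 1 else 0

/-- The signs of the quadratic characters at the points, a bit mask for each prime. -/
def charMask : Fin 28 → ℕ := ![
    94108775, 93236278, 164387395, 214454481, 109409150, 42262721, 96514246,
    163709569, 238074569, 134447289, 251056290, 252843487, 79886108, 121858091,
    256671745, 27066118, 178591974, 172481311, 135659577, 97613346, 100526462,
    131162161, 117980165, 134332701, 23415854, 128774706, 162514489, 99652978]

/-- The inverse modulo `2` of the matrix of signs. -/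
def charMaskInv : Fin 28 → ℕ := ![
    70046123, 73637857, 104999137, 78585927, 123732930, 124572459, 92686870,
    55157211, 31764195, 231091750, 216920458, 86989177, 95886652, 72634153,
    69885468, 68843655, 130116163, 120170734, 27603500, 9630771, 20153139,
    90819296, 212394072, 79294144, 45072468, 60526360, 195672275, 120862964]

theorem bitMatrix_inv_mul : bitMatrix charMaskInv * bitMatrix charMask = 1 := by
  decide +kernel

theorem prime_charPrime (k : Fin 28) : (charPrime k).Prime := by
  fin_cases k <;> norm_num [charPrime]

/-- The exponent of the sign of the `k`-th quadratic character at the `i`-th point. -/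
def charExp (k i : Fin 28) : ℤ := if (charMask k).testBit i then 1 else 0

theorem intCast_charExp (k i : Fin 28) : (charExp k i : ZMod 2) = bitMatrix charMask k i := by
  rw [charExp, bitMatrix, Matrix.of_apply]
  split_ifs
  · exact Int.cast_one
  · exact Int.cast_zero

/-- Euler's criterion in integer arithmetic, so that the kernel can evaluate all the character
values. -/
theorem pow_emod_charPrime : ∀ k i : Fin 28,
    ((pointX i - charRoot k) % charPrime k) ^ (charPrime k / 2) % charPrime k
      = if (charMask k).testBit i then (charPrime k : ℤ) - 1 else 1 := by
  decide +kernel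

theorem quadraticChar_pointX (k i : Fin 28) [Fact (charPrime k).Prime] (hk : charPrime k ≠ 2) :
    quadraticChar (ZMod (charPrime k)) ((pointX i : ZMod (charPrime k)) - charRoot k)
      = (charExp k i).negOnePow := by
  set a : ZMod (charPrime k) := (pointX i : ZMod (charPrime k)) - charRoot k with ha
  have hpow : a ^ (charPrime k / 2) = if (charMask k).testBit i then -1 else 1 := by
    have h := congrArg (fun t : ℤ => (t : ZMod (charPrime k))) (pow_emod_charPrime k i)
    simpa [apply_ite, ha] using h
  have hne : (-1 : ZMod (charPrime k)) ≠ 1 := by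
    have : Fact (2 < charPrime k) := ⟨lt_of_le_of_ne (prime_charPrime k).two_le hk.symm⟩
    exact ZMod.neg_one_ne_one
  have ha0 : a ≠ 0 := by
    intro h0
    rw [h0, zero_pow (Nat.div_pos (prime_charPrime k).two_le two_pos).ne'] at hpow
    split_ifs at hpow <;> simp at hpow
  rw [charExp]
  split_ifs at hpow ⊢ with hbit
  · rw [Int.negOnePow_one, Units.val_neg, Units.val_one, quadraticChar_neg_one_iff_not_isSquare,
      ZMod.euler_criterion _ ha0, hpow]
    exact hne
  · rw [Int.negOnePow_zero, Units.val_one, quadraticChar_one_iff_isSquare ha0,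
      ZMod.euler_criterion _ ha0, hpow]

theorem charRoot_isRoot : ∀ k : Fin 28, (charPrime k : ℤ) ∣ 4 * charRoot k ^ 3
    + (-3) * charRoot k ^ 2 + 2 * (-40135524831151053170066416418677085501860460624357913003) * charRoot k
    + 137926447180122225868131942761562881499423777437276721445064033185167757794928973717 := by
  decide +kernel

theorem charRoot_isSimple : ∀ k : Fin 28, ¬ (charPrime k : ℤ) ∣ 12 * charRoot k ^ 2
    + 2 * (-3) * charRoot k + 2 * (-40135524831151053170066416418677085501860460624357913003) := by
  decide +kernel

theorem charPrime_ne_two : ∀ k : Fin 28, charPrime k ≠ 2 := by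
  decide +kernel

/-- Each character gives one row of a linear system over `ZMod 2` satisfied by the coefficients; the
explicit left inverse leaves only the zero solution. -/
theorem linearIndependent_elkiesPoint : LinearIndependent ℤ elkiesPoint := by
  refine linearIndependent_of_forall_even eq_zero_of_add_self_eq_zero fun n hn i => ?_
  have hker : Matrix.mulVec (bitMatrix charMask) (fun i => (n i : ZMod 2)) = 0 := by
    ext k
    have : Fact (charPrime k).Prime := ⟨prime_charPrime k⟩
    have heven := even_sum_of_sum_smul_eq_zero curve_b₂ curve_b₄ curve_b₆ twoDivision_ne_zero
      (charRoot_isRoot k) (charRoot_isSimple k) (x := pointX) (fun i => ⟨_, _, rfl⟩)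
      (fun i => quadraticChar_pointX k i (charPrime_ne_two k)) n hn
    rw [← ZMod.intCast_eq_zero_iff_even] at heven
    rw [Pi.zero_apply, ← heven, Int.cast_sum, Matrix.mulVec, dotProduct]
    refine Finset.sum_congr rfl fun i _ => ?_
    rw [Int.cast_mul, intCast_charExp, mul_comm]
  have hzero := congrArg (Matrix.mulVec (bitMatrix charMaskInv)) hker
  rw [Matrix.mulVec_mulVec, bitMatrix_inv_mul, Matrix.one_mulVec, Matrix.mulVec_zero] at hzero
  exact ZMod.intCast_eq_zero_iff_even.mp (congrFun hzero i)

end RankTwentyEight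

theorem mainTheorem5 :
    RankTwentyEight.curve.IsElliptic ∧
    (∀ Q : RankTwentyEight.curve.toAffine.Point,
      Filter.Tendsto
        (fun n : ℕ => RankTwentyEight.naiveHeight ((2 ^ n : ℕ) • Q) / (4 : ℝ) ^ n)
        Filter.atTop (𝓝 (RankTwentyEight.canonicalHeight Q))) ∧
    (∃ P : Fin 28 → RankTwentyEight.curve.toAffine.Point,
      0 < RankTwentyEight.regulator P ∧ LinearIndependent ℤ P) ∧
    28 ≤ Module.rank ℤ RankTwentyEight.curve.toAffine.Point := by
  have hli := RankTwentyEight.linearIndependent_elkiesPoint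
  refine ⟨RankTwentyEight.curve_isElliptic,
    RankTwentyEight.tendsto_canonicalHeight RankTwentyEight.curve,
    ⟨_, RankTwentyEight.regulator_pos RankTwentyEight.curve hli, hli⟩, ?_⟩
  simpa using hli.cardinal_lift_le_rank
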